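/- There exists a real number $\eta$ with $0<\eta\le 1$ and an integer $k_0$ such that, for every integer $k\ge k_0$, there are two homogeneous polynomials $p_k, q_k\in\mathbb{C}[z,w]$ of degree $k$ for which the map $(p_k,q_k):\mathbb{C}^2\to\mathbb{C}^2$ takes the unit sphere $S^3=\{(z,w)\in\mathbb{C}^2:|z|^2+|w|^2=1\}$ into the closed annulus of inner radius $\sqrt{\eta}$ and outer radius $1$ centred at the origin of $\mathbb{C}^2$; that is, $$\eta\le |p_k(z,w)|^2+|q_k(z,w)|^2\le 1\qquad\text{whenever } |z|^2+|w|^2=1 .$$ -/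

import Mathlib

open Set

/-- The polynomial map `(p, q) : ℂ² → ℂ²`, `x ↦ (p(x), q(x))`, where `ℂ²` carries its standard
Hermitian norm. -/
noncomputable def polyMap (p q : MvPolynomial (Fin 2) ℂ) (x : EuclideanSpace ℂ (Fin 2)) :
    EuclideanSpace ℂ (Fin 2) :=
  !₂[MvPolynomial.eval (fun i => x i) p, MvPolynomial.eval (fun i => x i) q]

/-- The closed annulus in `ℂ²` centred at the origin with inner radius `r` and outer radius `R`. -/
def closedAnnulus (r R : ℝ) : Set (EuclideanSpace ℂ (Fin 2)) :=
  {y | r ≤ ‖y‖ ∧ ‖y‖ ≤ R}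

/-! On the sphere of squared radius `k`, the normalized monomial `z ^ a * w ^ (k - a)` has modulus
at most 1, attained where `|z| ^ 2 = a`. Exponents from 0 to `k` are chosen about a peak's width
apart (`exists_goodGap_chain`): far enough that moduli drop by a factor 5 per step away from a given
point (`peak_right_le`, `peak_left_le`), close enough that some peak is never small
(`exp_neg_le_max`). Even-indexed monomials make up `p`, odd-indexed ones `q`, so the two dominant
neighbours never cancel and the geometric tails cannot kill the larger one (`even_odd_sum_bounds`).
-/

/-! ### Size of a single peak -/

/-- The modulus at `(X, Y)` of the monomial `z ^ a * w ^ b`, normalized to have maximum `1` on the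
sphere of squared radius `a + b`. -/
noncomputable def peak (a b : ℕ) (X Y : ℝ) : ℝ :=
  (X / √a) ^ a * (Y / √b) ^ b

theorem peak_swap (a b : ℕ) (X Y : ℝ) : peak a b X Y = peak b a Y X := mul_comm _ _

theorem peak_nonneg (a b : ℕ) {X Y : ℝ} (hX : 0 ≤ X) (hY : 0 ≤ Y) : 0 ≤ peak a b X Y := by
  unfold peak; positivity

theorem pow_le_exp_mul_sub {x : ℝ} (hx : 0 ≤ x) (n : ℕ) : x ^ n ≤ Real.exp (n * (x - 1)) := by
  rw [Real.exp_nat_mul]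
  have h := Real.add_one_le_exp (x - 1)
  exact pow_le_pow_left₀ hx (by linarith) n

theorem natCast_mul_div_sqrt (a : ℕ) (X : ℝ) : (a : ℝ) * (X / √a) = √a * X := by
  rw [mul_div_assoc', mul_comm, mul_div_assoc, Real.div_sqrt, mul_comm]

theorem peak_le_exp (a b : ℕ) {X Y : ℝ} (hX : 0 ≤ X) (hY : 0 ≤ Y) :
    peak a b X Y ≤ Real.exp (√a * X + √b * Y - (a + b)) := by
  have h1 := pow_le_exp_mul_sub (x := X / √a) (by positivity) a
  have h2 := pow_le_exp_mul_sub (x := Y / √b) (by positivity) b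
  calc peak a b X Y ≤ _ := mul_le_mul h1 h2 (by positivity) (by positivity)
    _ = _ := by
      rw [← Real.exp_add, mul_sub, mul_sub, natCast_mul_div_sqrt, natCast_mul_div_sqrt]
      ring_nf

theorem peak_le_one {a b : ℕ} {X Y : ℝ} (hX : 0 ≤ X) (hY : 0 ≤ Y)
    (h : X ^ 2 + Y ^ 2 = a + b) : peak a b X Y ≤ 1 := by
  refine (peak_le_exp a b hX hY).trans (Real.exp_le_one_iff.2 ?_)
  nlinarith [sq_nonneg (√a - X), sq_nonneg (√b - Y), Real.sq_sqrt (Nat.cast_nonneg (α := ℝ) a),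
    Real.sq_sqrt (Nat.cast_nonneg (α := ℝ) b)]

theorem peak_self (a b : ℕ) : peak a b √a √b = 1 := by
  have h (n : ℕ) : (√(n : ℝ) / √n) ^ n = 1 := by
    -- For `n = 0` the base is `0 / 0 = 0`, but the exponent 0 gives 1.
    rcases Nat.eq_zero_or_pos n with rfl | hn
    · simp
    · have : (0 : ℝ) < √n := by positivity
      rw [div_self this.ne', one_pow]
  simp [peak, h]

/-- Applying `x ≤ exp (x - 1)` to the reciprocals `a / X ^ 2` and `b / Y ^ 2` bounds the inverse
squared peak from above. -/
theorem exp_neg_le_peak_sq {a b : ℕ} {X Y C : ℝ} (hX : 0 ≤ X) (hY : 0 ≤ Y)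
    (h : X ^ 2 + Y ^ 2 = a + b)
    (hC : (X ^ 2 - a) ^ 2 * (a + b) ≤ C * (X ^ 2 * Y ^ 2)) :
    Real.exp (-C) ≤ peak a b X Y ^ 2 ∨ X = 0 ∨ Y = 0 := by
  rcases hX.eq_or_lt with rfl | hX
  · simp
  rcases hY.eq_or_lt with rfl | hY
  · simp
  left
  have key : peak a b X Y ^ 2 * ((a / X ^ 2) ^ a * (b / Y ^ 2) ^ b) = 1 := by
    have e (n : ℕ) {x : ℝ} (hx : 0 < x) : ((x / √n) ^ n) ^ 2 * (n / x ^ 2) ^ n = 1 := by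
      rcases Nat.eq_zero_or_pos n with rfl | hn
      · simp
      · have : (0 : ℝ) < n := by positivity
        rw [← pow_mul, mul_comm n 2, pow_mul, ← mul_pow, div_pow, Real.sq_sqrt this.le,
          div_mul_div_cancel₀ this.ne', div_self (by positivity), one_pow]
    have := congrArg₂ (· * ·) (e a hX) (e b hY)
    simp only [mul_one] at this
    rw [← this, peak]
    ring
  have h1 := pow_le_exp_mul_sub (x := a / X ^ 2) (by positivity) a
  have h2 := pow_le_exp_mul_sub (x := b / Y ^ 2) (by positivity) b
  have h3 : (a / X ^ 2 : ℝ) ^ a * (b / Y ^ 2) ^ b ≤ Real.exp C := by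
    refine (mul_le_mul h1 h2 (by positivity) (by positivity)).trans ?_
    rw [← Real.exp_add, Real.exp_le_exp]
    have hb : (b : ℝ) = X ^ 2 + Y ^ 2 - a := by linarith
    have : (a * (a / X ^ 2 - 1) + b * (b / Y ^ 2 - 1) : ℝ)
        = (X ^ 2 - a) ^ 2 * (a + b) / (X ^ 2 * Y ^ 2) := by
      rw [hb]; field_simp; ring
    rw [this, div_le_iff₀ (by positivity)]
    exact hC
  rw [Real.exp_neg, inv_le_iff_one_le_mul₀ (Real.exp_pos _), ← key]
  gcongr

/-- On the axes `hC` forces `X ^ 2 = a`, the centre, where the peak is 1. -/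
theorem exp_neg_le_peak_sq_of_le {a b : ℕ} {X Y C : ℝ} (hX : 0 ≤ X) (hY : 0 ≤ Y)
    (h : X ^ 2 + Y ^ 2 = a + b) (hk : 0 < a + b) (hC0 : 0 ≤ C)
    (hC : (X ^ 2 - a) ^ 2 * (a + b) ≤ C * (X ^ 2 * Y ^ 2)) :
    Real.exp (-C) ≤ peak a b X Y ^ 2 := by
  have hk' : (0 : ℝ) < a + b := by exact_mod_cast hk
  have ha : X = 0 ∨ Y = 0 → X ^ 2 = a := by
    intro h0
    have : (X ^ 2 - a) ^ 2 * (a + b) ≤ 0 := by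
      refine hC.trans (le_of_eq ?_); rcases h0 with h0 | h0 <;> simp [h0]
    have : (X ^ 2 - a) ^ 2 ≤ 0 := nonpos_of_mul_nonpos_left this hk'
    have := pow_eq_zero_iff (two_ne_zero) |>.1 (le_antisymm this (sq_nonneg _))
    linarith
  rcases exp_neg_le_peak_sq hX hY h hC with h1 | h1
  · exact h1
  · have hXa := ha h1
    have hYb : Y ^ 2 = b := by linarith
    rw [show X = √a by rw [← hXa, Real.sqrt_sq hX], show Y = √b by rw [← hYb, Real.sqrt_sq hY],
      peak_self, one_pow, Real.exp_le_one_iff]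
    linarith

/-- Comparison of two peaks at a point lying beyond the centre of the first one. -/
theorem peak_le_mul_peak {a a' b b' : ℕ} (hk : a + a' = b + b') (hab : a ≤ b) {X Y : ℝ}
    (hX : 0 ≤ X) (hY : 0 ≤ Y) (h : X * √a' ≤ Y * √a) :
    peak b b' X Y ≤ peak a a' X Y * peak b b' √a √a' := by
  obtain ⟨d, rfl⟩ := Nat.exists_eq_add_of_le hab
  obtain rfl : a' = d + b' := by omega
  set B : ℕ := a + d
  have h1 : peak B b' X Y = peak B b' X Y * peak a (d + b') √a √(d + b' : ℕ) := by
    rw [peak_self, mul_one]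
  rw [h1]
  simp only [peak, div_pow, div_mul_div_comm]
  rw [mul_comm (√(B : ℝ) ^ B * √b' ^ b')]
  gcongr ?_ / _
  -- The ratio of the peaks is a constant times `(X / Y) ^ d`, hence increasing in `X / Y`.
  have h2 : (X * √(d + b' : ℕ)) ^ d ≤ (Y * √a) ^ d := by gcongr
  calc X ^ B * Y ^ b' * (√a ^ a * √(d + b' : ℕ) ^ (d + b'))
      = (X ^ a * Y ^ b' * √a ^ a * √(d + b' : ℕ) ^ b') * (X * √(d + b' : ℕ)) ^ d := by
        simp only [B]; ring
    _ ≤ (X ^ a * Y ^ b' * √a ^ a * √(d + b' : ℕ) ^ b') * (Y * √a) ^ d := by gcongr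
    _ = _ := by simp only [B]; ring

theorem exp_neg_two_le : Real.exp (-2) ≤ 1 / 5 := by
  have h := Real.exp_one_gt_d9
  rw [Real.exp_neg, show (2 : ℝ) = 1 + 1 by norm_num, Real.exp_add, inv_le_comm₀ (by positivity)
    (by norm_num)]
  nlinarith

/-! ### Good gaps between exponents -/

/-- Consecutive exponents `a < b` for which the peaks of degree `k` are well separated, while at
least one of them is not small at every point between their centres. -/
structure GoodGap (C : ℝ) (k a b : ℕ) : Prop where
  le : a ≤ b
  le_deg : b ≤ k
  sep : √a * √b + √(k - a : ℕ) * √(k - b : ℕ) ≤ k - 2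
  cover : ∀ u : ℝ, a ≤ u → u ≤ b →
    (u - a) ^ 2 * k ≤ C * (u * (k - u)) ∨ (u - b) ^ 2 * k ≤ C * (u * (k - u))

namespace GoodGap

variable {C : ℝ} {k a b : ℕ}

theorem reflect (h : GoodGap C k a b) : GoodGap C k (k - b) (k - a) where
  le := Nat.sub_le_sub_left h.le k
  le_deg := Nat.sub_le k a
  sep := by
    rw [Nat.sub_sub_self h.le_deg, Nat.sub_sub_self (h.le.trans h.le_deg)]
    linarith [h.sep]
  cover u h1 h2 := by
    rw [Nat.cast_sub h.le_deg] at h1 ⊢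
    rw [Nat.cast_sub (h.le.trans h.le_deg)] at h2 ⊢
    rcases h.cover (k - u) (by linarith) (by linarith) with h3 | h3
    · right; convert h3 using 1 <;> ring
    · left; convert h3 using 1 <;> ring

/-- `sep` says that the centres `(√a, √(k - a))` and `(√b, √(k - b))` are at distance at least 2;
the first coordinates alone ensure this. -/
theorem of_sqrt (hbk : b ≤ k) (hs : √(a : ℝ) + 2 ≤ √b)
    (hc : ∀ u : ℝ, a ≤ u → u ≤ b → (u - a) ^ 2 * k ≤ C * (u * (k - u))) : GoodGap C k a b := by
  have hab : a ≤ b := by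
    have : √(a : ℝ) ≤ √b := by linarith
    exact_mod_cast (Real.sqrt_le_sqrt_iff (by positivity)).1 this
  refine ⟨hab, hbk, ?_, fun u h1 h2 => Or.inl (hc u h1 h2)⟩
  have ea := Real.sq_sqrt (Nat.cast_nonneg (α := ℝ) a)
  have eb := Real.sq_sqrt (Nat.cast_nonneg (α := ℝ) b)
  have ea' := Real.sq_sqrt (Nat.cast_nonneg (α := ℝ) (k - a))
  have eb' := Real.sq_sqrt (Nat.cast_nonneg (α := ℝ) (k - b))
  rw [Nat.cast_sub (hab.trans hbk)] at ea' ⊢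
  rw [Nat.cast_sub hbk] at eb' ⊢
  nlinarith [sq_nonneg (√(k - a : ℝ) - √(k - b : ℝ))]

theorem of_squares {j : ℕ} (hj : 8 * (j + 1) ^ 2 ≤ k) :
    GoodGap 2048 k (4 * j ^ 2) (4 * (j + 1) ^ 2) := by
  have hj' : (8 * (j + 1) ^ 2 : ℝ) ≤ k := by exact_mod_cast hj
  refine of_sqrt (by omega) ?_ ?_
  · push_cast
    rw [show (4 * j ^ 2 : ℝ) = (2 * j) ^ 2 by ring,
      show (4 * (j + 1) ^ 2 : ℝ) = (2 * (j + 1)) ^ 2 by ring, Real.sqrt_sq (by positivity),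
      Real.sqrt_sq (by positivity)]
    linarith
  · push_cast
    intro u h1 h2
    have h3 : (u - 4 * j ^ 2) ^ 2 ≤ 36 * u := by
      rcases Nat.eq_zero_or_pos j with rfl | hj0
      · norm_num at h1 h2 ⊢; nlinarith
      · have hj1 : (1 : ℝ) ≤ j := by exact_mod_cast hj0
        have : (u - 4 * j ^ 2) ^ 2 ≤ (12 * j) ^ 2 :=
          pow_le_pow_left₀ (by linarith) (by nlinarith) 2
        nlinarith
    have hu : 0 ≤ u := le_trans (by positivity) h1
    have h4 : (k : ℝ) ≤ 2 * (k - u) := by linarith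
    calc (u - 4 * j ^ 2) ^ 2 * k ≤ 36 * u * (2 * (k - u)) := by gcongr
      _ ≤ 2048 * (u * (k - u)) := by nlinarith [mul_nonneg hu (show 0 ≤ k - u by linarith)]

/-- Joins the squares to their reflections. Ending at `J + 1` rather than `J + 2` leaves room for
the separation by 2. -/
theorem middle {J : ℕ} (h1 : 8 * (J + 3) ^ 2 ≤ k) (h2 : k < 8 * (J + 4) ^ 2) (hJ : 2 ≤ J) :
    GoodGap 2048 k (4 * (J + 3) ^ 2) (k - 4 * (J + 1) ^ 2) := by
  have hle : 4 * (J + 1) ^ 2 ≤ k := by nlinarith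
  have h1' : (8 * (J + 3) ^ 2 : ℝ) ≤ k := by exact_mod_cast h1
  have h2' : (k : ℝ) ≤ 8 * (J + 4) ^ 2 := by exact_mod_cast h2.le
  have hJ' : (2 : ℝ) ≤ J := by exact_mod_cast hJ
  refine of_sqrt (Nat.sub_le _ _) ?_ ?_
  · rw [Nat.cast_sub hle]
    push_cast
    rw [show (4 * (J + 3) ^ 2 : ℝ) = (2 * (J + 3)) ^ 2 by ring, Real.sqrt_sq (by positivity)]
    apply Real.le_sqrt_of_sq_le
    nlinarith
  · rw [Nat.cast_sub hle]
    push_cast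
    intro u h3 h4
    have hu : 0 ≤ u := le_trans (by positivity) h3
    have h5 : (u - 4 * (J + 3) ^ 2) ^ 2 ≤ 256 * u := by
      have : (u - 4 * (J + 3) ^ 2) ^ 2 ≤ (32 * (J + 3)) ^ 2 :=
        pow_le_pow_left₀ (by linarith) (by nlinarith) 2
      nlinarith
    -- Needs `J + 4 ≤ 2 * (J + 1)`, whence `2 ≤ J` and the threshold `200 = 8 * 5 ^ 2`.
    have h6 : (k : ℝ) ≤ 8 * (k - u) := by nlinarith
    calc (u - 4 * (J + 3) ^ 2) ^ 2 * k ≤ 256 * u * (8 * (k - u)) := by gcongr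
      _ = 2048 * (u * (k - u)) := by ring

theorem peak_right_le (h : GoodGap C k a b) {X Y : ℝ} (hX : 0 ≤ X) (hY : 0 ≤ Y)
    (hXY : X ^ 2 + Y ^ 2 = k) (hXa : X ^ 2 ≤ a) :
    peak b (k - b) X Y ≤ peak a (k - a) X Y * (1 / 5) := by
  have hak := h.le.trans h.le_deg
  have h1 : X ≤ √a := Real.le_sqrt_of_sq_le hXa
  have h2 : √(k - a : ℕ) ≤ Y := by
    rw [Real.sqrt_le_left hY, Nat.cast_sub hak]; linarith
  have hp := h.le_deg
  have h3 : X * √(k - a : ℕ) ≤ Y * √a := by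
    rw [mul_comm Y]; exact mul_le_mul h1 h2 (by positivity) (by positivity)
  refine (peak_le_mul_peak (by omega) h.le hX hY h3).trans ?_
  refine mul_le_mul_of_nonneg_left ?_ (peak_nonneg _ _ hX hY)
  refine (peak_le_exp _ _ (by positivity) (by positivity)).trans (le_trans ?_ exp_neg_two_le)
  rw [Real.exp_le_exp, Nat.cast_sub h.le_deg]
  have := h.sep
  rw [Nat.cast_sub h.le_deg] at this
  linarith

theorem peak_left_le (h : GoodGap C k a b) {X Y : ℝ} (hX : 0 ≤ X) (hY : 0 ≤ Y)
    (hXY : X ^ 2 + Y ^ 2 = k) (hXb : b ≤ X ^ 2) :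
    peak a (k - a) X Y ≤ peak b (k - b) X Y * (1 / 5) := by
  have h1 := h.reflect.peak_right_le hY hX (by linarith)
    (by rw [Nat.cast_sub h.le_deg]; linarith)
  rw [Nat.sub_sub_self h.le_deg, Nat.sub_sub_self (h.le.trans h.le_deg)] at h1
  rwa [peak_swap a, peak_swap b]

theorem exp_neg_le_max (h : GoodGap C k a b) (hC : 0 ≤ C) (hk : 0 < k) {X Y : ℝ} (hX : 0 ≤ X)
    (hY : 0 ≤ Y) (hXY : X ^ 2 + Y ^ 2 = k) (hXa : a ≤ X ^ 2) (hXb : X ^ 2 ≤ b) :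
    Real.exp (-C) ≤ max (peak a (k - a) X Y) (peak b (k - b) X Y) ^ 2 := by
  have key (n : ℕ) (hn : n ≤ k)
      (hu : (X ^ 2 - n) ^ 2 * k ≤ C * (X ^ 2 * (k - X ^ 2))) :
      Real.exp (-C) ≤ peak n (k - n) X Y ^ 2 := by
    have e : (n : ℝ) + (k - n : ℕ) = k := by rw [Nat.cast_sub hn]; ring
    refine exp_neg_le_peak_sq_of_le hX hY (hXY.trans e.symm) (by omega) hC ?_
    rw [e, show Y ^ 2 = k - X ^ 2 by linarith]
    exact hu
  rcases h.cover _ hXa hXb with hu | hu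
  · refine (key a (h.le.trans h.le_deg) hu).trans ?_
    exact pow_le_pow_left₀ (peak_nonneg _ _ hX hY) (le_max_left _ _) 2
  · refine (key b h.le_deg hu).trans ?_
    exact pow_le_pow_left₀ (peak_nonneg _ _ hX hY) (le_max_right _ _) 2

end GoodGap

/-- A chain of exponents from `0` to `k` all of whose gaps are good. -/
theorem exists_goodGap_chain {k : ℕ} (hk : 200 ≤ k) :
    ∃ (m : ℕ) (n : ℕ → ℕ), n 0 = 0 ∧ n m = k ∧ ∀ i < m, GoodGap 2048 k (n i) (n (i + 1)) := by
  obtain ⟨J, hJ1, hJ2, hJ⟩ : ∃ J, 8 * (J + 3) ^ 2 ≤ k ∧ k < 8 * (J + 4) ^ 2 ∧ 2 ≤ J := by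
    have h1 : Nat.sqrt (k / 8) ^ 2 ≤ k / 8 := Nat.sqrt_le' _
    have h2 : k / 8 < (Nat.sqrt (k / 8) + 1) ^ 2 := Nat.lt_succ_sqrt' _
    have h3 : 5 ≤ Nat.sqrt (k / 8) := by rw [Nat.le_sqrt]; omega
    obtain ⟨J, hJ⟩ := Nat.exists_eq_add_of_le h3
    refine ⟨J + 2, ?_, ?_, by omega⟩
    · rw [show J + 2 + 3 = Nat.sqrt (k / 8) by omega]; omega
    · rw [show J + 2 + 4 = Nat.sqrt (k / 8) + 1 by omega]; omega
  refine ⟨2 * J + 5, fun i => if i ≤ J + 3 then 4 * i ^ 2 else k - 4 * (2 * J + 5 - i) ^ 2,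
    by simp, ?_, fun i hi => ?_⟩
  · simp only [if_neg (show ¬ 2 * J + 5 ≤ J + 3 by omega)]; simp
  · rcases lt_trichotomy i (J + 3) with h | rfl | h
    · simp only [if_pos (show i ≤ J + 3 by omega), if_pos (show i + 1 ≤ J + 3 by omega)]
      refine GoodGap.of_squares (le_trans ?_ hJ1)
      have : i + 1 ≤ J + 3 := by omega
      gcongr
    · simp only [if_pos le_rfl, if_neg (show ¬ J + 3 + 1 ≤ J + 3 by omega)]
      rw [show 2 * J + 5 - (J + 3 + 1) = J + 1 by omega]
      exact GoodGap.middle hJ1 hJ2 hJ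
    · simp only [if_neg (show ¬ i ≤ J + 3 by omega), if_neg (show ¬ i + 1 ≤ J + 3 by omega)]
      obtain ⟨l, hl⟩ : ∃ l, 2 * J + 5 - (i + 1) = l := ⟨_, rfl⟩
      rw [hl, show 2 * J + 5 - i = l + 1 by omega]
      refine (GoodGap.of_squares (le_trans ?_ hJ1)).reflect
      have : l + 1 ≤ J + 3 := by omega
      gcongr

theorem exists_mem_Icc_of_chain (n : ℕ → ℝ) {u : ℝ} {m : ℕ} (h0 : n 0 ≤ u) (hm : u ≤ n m)
    (hpos : 0 < m) : ∃ i < m, n i ≤ u ∧ u ≤ n (i + 1) := by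
  induction m with
  | zero => omega
  | succ m ih =>
    by_cases h : n m ≤ u
    · exact ⟨m, by omega, h, hm⟩
    · rcases Nat.eq_zero_or_pos m with rfl | hm0
      · exact absurd h0 h
      · obtain ⟨i, hi, h'⟩ := ih (le_of_not_ge h) hm0
        exact ⟨i, by omega, h'⟩

/-! ### Sums dominated by two neighbours -/

/-- The sum of a sequence decaying by a factor `5` at each step is at most `5/4` of the first
term. -/
theorem sum_range_le_of_decay (f : ℕ → ℝ) (N : ℕ) (hN : ∀ i, 0 ≤ f i)
    (h : ∀ i, i + 1 < N → f (i + 1) ≤ f i * (1 / 5)) : ∑ i ∈ Finset.range N, f i ≤ 5 / 4 * f 0 := by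
  induction N generalizing f with
  | zero => simpa using hN 0
  | succ N ih =>
    rw [Finset.sum_range_succ']
    rcases Nat.eq_zero_or_pos N with rfl | hN0
    · simp; linarith [hN 0]
    · have h1 := ih (fun i => f (i + 1)) (fun i => hN _) (fun i hi => h (i + 1) (by omega))
      have h2 := h 0 (by omega)
      simp only [zero_add] at h1 h2
      linarith

/-- Splitting `range (m + 1)` at `i` and `i + 1`. -/
theorem sum_range_split {M : Type*} [AddCommMonoid M] (f : ℕ → M) {m i : ℕ} (hi : i < m) :
    ∑ j ∈ Finset.range (m + 1), f j =
      ∑ j ∈ Finset.range (i + 1), f (i - j) + ∑ j ∈ Finset.range (m - i), f (i + 1 + j) := by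
  obtain ⟨d, rfl⟩ := Nat.exists_eq_add_of_lt hi
  rw [show i + d + 1 + 1 = (i + 1) + (d + 1) by omega, Finset.sum_range_add,
    show i + d + 1 - i = d + 1 by omega, ← Finset.sum_range_reflect f (i + 1)]
  simp

/-- Two-sided bounds for the sums over even and over odd indices of a sequence whose moduli decay
geometrically away from a pair of consecutive indices. -/
theorem even_odd_sum_bounds (τ : ℕ → ℂ) {m i : ℕ} (hi : i < m)
    (hR : ∀ j, i + 1 ≤ j → j < m → ‖τ (j + 1)‖ ≤ ‖τ j‖ * (1 / 5))
    (hL : ∀ j < i, ‖τ j‖ ≤ ‖τ (j + 1)‖ * (1 / 5)) :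
    let S := ‖∑ j ∈ Finset.range (m + 1) with j % 2 = 0, τ j‖ ^ 2 +
      ‖∑ j ∈ Finset.range (m + 1) with j % 2 = 1, τ j‖ ^ 2
    (max ‖τ i‖ ‖τ (i + 1)‖ / 2) ^ 2 ≤ S ∧ S ≤ (5 / 2 * max ‖τ i‖ ‖τ (i + 1)‖) ^ 2 := by
  intro S
  have hleft : ∑ j ∈ Finset.range (i + 1), ‖τ (i - j)‖ ≤ 5 / 4 * ‖τ i‖ := by
    refine sum_range_le_of_decay (fun j => ‖τ (i - j)‖) _ (fun _ => norm_nonneg _) ?_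
    intro j hj
    have := hL (i - (j + 1)) (by omega)
    rwa [show i - (j + 1) + 1 = i - j by omega] at this
  have hright : ∑ j ∈ Finset.range (m - i), ‖τ (i + 1 + j)‖ ≤ 5 / 4 * ‖τ (i + 1)‖ := by
    refine sum_range_le_of_decay (fun j => ‖τ (i + 1 + j)‖) _
      (fun _ => norm_nonneg _) ?_
    intro j hj
    exact hR (i + 1 + j) (by omega) (by omega)
  have hall : ∑ j ∈ Finset.range (m + 1), ‖τ j‖ ≤ 5 / 4 * ‖τ i‖ + 5 / 4 * ‖τ (i + 1)‖ := by
    rw [sum_range_split _ hi]; exact add_le_add hleft hright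
  set A := max ‖τ i‖ ‖τ (i + 1)‖
  have hA1 : ‖τ i‖ ≤ A := le_max_left _ _
  have hA2 : ‖τ (i + 1)‖ ≤ A := le_max_right _ _
  have hA0 : 0 ≤ A := (norm_nonneg _).trans hA1
  let s (r : ℕ) := (Finset.range (m + 1)).filter (fun j => j % 2 = r)
  have hlow (r l : ℕ) (hl : l = i ∨ l = i + 1) (hr : l % 2 = r) (hmax : ‖τ l‖ = A) :
      A / 2 ≤ ‖∑ j ∈ s r, τ j‖ := by
    have hls : l ∈ s r := by simp [s]; omega
    have h1 : ∑ j ∈ (s r).erase l, ‖τ j‖ ≤ A / 2 := by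
      -- `i` and `i + 1` differ in parity, so only tail terms remain, of total at most `(1/4 + 1/4)
      -- * A`.
      have hsub : (s r).erase l ⊆ ((Finset.range (m + 1)).erase i).erase (i + 1) := by
        intro j hj
        simp only [s, Finset.mem_erase, Finset.mem_filter, Finset.mem_range] at hj ⊢
        omega
      have h2 := Finset.sum_le_sum_of_subset_of_nonneg hsub
        (f := fun j => ‖τ j‖) (fun _ _ _ => norm_nonneg _)
      have h3 := Finset.add_sum_erase (Finset.range (m + 1)) (fun j => ‖τ j‖)
        (a := i) (by simp; omega)
      have h4 := Finset.add_sum_erase ((Finset.range (m + 1)).erase i) (fun j => ‖τ j‖)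
        (a := i + 1) (by simp; omega)
      linarith
    have h2 := Finset.add_sum_erase (s r) τ hls
    have h3 := norm_sum_le ((s r).erase l) τ
    rw [← h2]
    have h4 := norm_sub_le_norm_add (τ l) (∑ j ∈ (s r).erase l, τ j)
    linarith
  constructor
  · have hmod := Nat.mod_two_eq_zero_or_one
    obtain ⟨l, hl, hmax⟩ : ∃ l, (l = i ∨ l = i + 1) ∧ ‖τ l‖ = A := by
      rcases max_choice ‖τ i‖ ‖τ (i + 1)‖ with h | h
      · exact ⟨i, Or.inl rfl, h.symm⟩
      · exact ⟨i + 1, Or.inr rfl, h.symm⟩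
    rcases hmod l with h | h
    · have := pow_le_pow_left₀ (by positivity) (hlow 0 l hl h hmax) 2
      exact this.trans (le_add_of_nonneg_right (sq_nonneg _))
    · have := pow_le_pow_left₀ (by positivity) (hlow 1 l hl h hmax) 2
      exact this.trans (le_add_of_nonneg_left (sq_nonneg _))
  · have h0 := norm_sum_le (s 0) τ
    have h1 := norm_sum_le (s 1) τ
    have h2 : ∑ j ∈ s 0, ‖τ j‖ + ∑ j ∈ s 1, ‖τ j‖ = ∑ j ∈ Finset.range (m + 1), ‖τ j‖ := by
      rw [← Finset.sum_filter_add_sum_filter_not (Finset.range (m + 1)) (fun j => j % 2 = 0)]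
      simp [s]
    have h3 : ‖∑ j ∈ s 0, τ j‖ + ‖∑ j ∈ s 1, τ j‖ ≤ 5 / 2 * A := by linarith
    have h4 := pow_le_pow_left₀ (by positivity) h3 2
    refine le_trans ?_ h4
    change ‖∑ j ∈ s 0, τ j‖ ^ 2 + ‖∑ j ∈ s 1, τ j‖ ^ 2 ≤ _
    nlinarith [mul_nonneg (norm_nonneg (∑ j ∈ s 0, τ j)) (norm_nonneg (∑ j ∈ s 1, τ j))]

/-! ### The polynomials -/

/-- The monomial of degree `a + b` whose modulus on the unit sphere is a peak. -/
noncomputable def peakMonomial (a b : ℕ) : MvPolynomial (Fin 2) ℂ :=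
  MvPolynomial.C (((√(a + b : ℝ) / √a) ^ a * (√(a + b : ℝ) / √b) ^ b : ℝ) : ℂ) *
    (MvPolynomial.X 0 ^ a * MvPolynomial.X 1 ^ b)

theorem peakMonomial_isHomogeneous (a b : ℕ) : (peakMonomial a b).IsHomogeneous (a + b) :=
  ((MvPolynomial.isHomogeneous_X_pow 0 a).mul (MvPolynomial.isHomogeneous_X_pow 1 b)).C_mul _

theorem norm_eval_peakMonomial (a b : ℕ) (x : Fin 2 → ℂ) :
    ‖MvPolynomial.eval x (peakMonomial a b)‖ =
      peak a b (√(a + b : ℝ) * ‖x 0‖) (√(a + b : ℝ) * ‖x 1‖) := by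
  have h : 0 ≤ (√(a + b : ℝ) / √a) ^ a * (√(a + b : ℝ) / √b) ^ b := by positivity
  simp only [peakMonomial, map_mul, map_pow, MvPolynomial.eval_C, MvPolynomial.eval_X, norm_mul,
    norm_pow, Complex.norm_real, Real.norm_of_nonneg h]
  simp only [peak, mul_div_right_comm, mul_pow]
  ring

theorem proposition1 :
    ∃ η : ℝ, 0 < η ∧ η ≤ 1 ∧
      ∃ k₀ : ℕ, ∀ k : ℕ, k₀ ≤ k →
        ∃ p q : MvPolynomial (Fin 2) ℂ,
          p.IsHomogeneous k ∧ q.IsHomogeneous k ∧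
            MapsTo (polyMap p q) (Metric.sphere (0 : EuclideanSpace ℂ (Fin 2)) 1)
              (closedAnnulus (Real.sqrt η) 1) := by
  -- The scaling `2 / 5` turns the upper bound `5 / 2` into 1 and the lower bound `1 / 2` into `1 /
  -- 5`, whose square is `1 / 25`.
  refine ⟨Real.exp (-2048) / 25, by positivity, ?_, 200, fun k hk => ?_⟩
  · have : Real.exp (-2048) ≤ 1 := Real.exp_le_one_iff.2 (by norm_num)
    linarith
  obtain ⟨m, n, hn0, hnm, hgap⟩ := exists_goodGap_chain hk
  have hm : 0 < m := by
    rcases Nat.eq_zero_or_pos m with rfl | h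
    · omega
    · exact h
  have hnk (j : ℕ) (hj : j ≤ m) : n j ≤ k := by
    rcases hj.eq_or_lt with rfl | h
    · exact hnm.le
    · exact (hgap j h).le.trans (hgap j h).le_deg
  let P (r : ℕ) : MvPolynomial (Fin 2) ℂ :=
    MvPolynomial.C (2 / 5) *
      ∑ j ∈ Finset.range (m + 1) with j % 2 = r, peakMonomial (n j) (k - n j)
  have hP (r : ℕ) : (P r).IsHomogeneous k := by
    refine (MvPolynomial.IsHomogeneous.sum _ _ _ fun j hj => ?_).C_mul _
    have := hnk j (by simp at hj; omega)
    have h := peakMonomial_isHomogeneous (n j) (k - n j)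
    rwa [Nat.add_sub_cancel' this] at h
  refine ⟨P 0, P 1, hP 0, hP 1, fun x hx => ?_⟩
  have hk0 : (0 : ℝ) < k := by exact_mod_cast (show 0 < k by omega)
  set X := √(k : ℝ) * ‖x 0‖ with hXdef
  set Y := √(k : ℝ) * ‖x 1‖ with hYdef
  have hX : 0 ≤ X := by positivity
  have hY : 0 ≤ Y := by positivity
  have hXY : X ^ 2 + Y ^ 2 = k := by
    have h1 : ‖x‖ ^ 2 = 1 := by rw [mem_sphere_zero_iff_norm.1 hx, one_pow]
    rw [EuclideanSpace.norm_sq_eq, Fin.sum_univ_two] at h1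
    rw [hXdef, hYdef, mul_pow, mul_pow, ← mul_add, h1, Real.sq_sqrt hk0.le, mul_one]
  let τ (j : ℕ) : ℂ := MvPolynomial.eval (fun i => x i) (peakMonomial (n j) (k - n j))
  have hτ (j : ℕ) (hj : j ≤ m) : ‖τ j‖ = peak (n j) (k - n j) X Y := by
    have e : (n j : ℝ) + (k - n j : ℕ) = k := by rw [Nat.cast_sub (hnk j hj)]; ring
    simp only [τ, norm_eval_peakMonomial, e, X, Y]
  have hmono (i j : ℕ) (hij : i ≤ j) (hj : j ≤ m) : n i ≤ n j := by
    induction j, hij using Nat.le_induction with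
    | base => exact le_rfl
    | succ j _ ih => exact (ih (by omega)).trans (hgap j (by omega)).le
  obtain ⟨i, hi, hui, hui'⟩ := exists_mem_Icc_of_chain (fun j => (n j : ℝ)) (u := X ^ 2) (m := m)
    (by simp [hn0]; positivity) (by simp only [hnm]; nlinarith) hm
  obtain ⟨hlow, hup⟩ := even_odd_sum_bounds τ hi
    (fun j hj1 hj2 => by
      rw [hτ j (by omega), hτ (j + 1) (by omega)]
      refine (hgap j hj2).peak_right_le hX hY hXY (hui'.trans ?_)
      exact_mod_cast hmono _ _ hj1 (by omega))
    (fun j hj => by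
      rw [hτ j (by omega), hτ (j + 1) (by omega)]
      refine (hgap j (by omega)).peak_left_le hX hY hXY (le_trans ?_ hui)
      exact_mod_cast hmono (j + 1) i hj (by omega))
  have hmax := (hgap i hi).exp_neg_le_max (by norm_num) (by omega) hX hY hXY hui hui'
  have hle1 (j : ℕ) (hj : j ≤ m) : ‖τ j‖ ≤ 1 := by
    rw [hτ j hj]
    exact peak_le_one hX hY (by rw [hXY, Nat.cast_sub (hnk j hj)]; ring)
  have hmax1 : max ‖τ i‖ ‖τ (i + 1)‖ ≤ 1 := max_le (hle1 i hi.le) (hle1 (i + 1) hi)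
  have hmax0 : 0 ≤ max ‖τ i‖ ‖τ (i + 1)‖ := (norm_nonneg _).trans (le_max_left _ _)
  rw [← hτ i hi.le, ← hτ (i + 1) hi] at hmax
  have hev (r : ℕ) : ‖MvPolynomial.eval (fun i => x i) (P r)‖ ^ 2 =
      4 / 25 * ‖∑ j ∈ Finset.range (m + 1) with j % 2 = r, τ j‖ ^ 2 := by
    simp only [P, map_mul, map_sum, MvPolynomial.eval_C, norm_mul, mul_pow, τ]
    norm_num
  have hnorm : ‖polyMap (P 0) (P 1) x‖ ^ 2 =
      4 / 25 * (‖∑ j ∈ Finset.range (m + 1) with j % 2 = 0, τ j‖ ^ 2 +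
        ‖∑ j ∈ Finset.range (m + 1) with j % 2 = 1, τ j‖ ^ 2) := by
    rw [EuclideanSpace.norm_sq_eq, Fin.sum_univ_two, mul_add, ← hev, ← hev]
    simp [polyMap]
  constructor
  · rw [Real.sqrt_le_left (norm_nonneg _), hnorm]
    linarith
  · refine (sq_le_one_iff₀ (norm_nonneg _)).1 ?_
    rw [hnorm]
    nlinarith
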